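/- Let $G$ be a group with a finite generating set $S$, equipped with the word metric $d=d_S$, i.e. the distance between vertices in the Cayley graph $\mathrm{Cay}(G,S)$. A geodesic is the image in $G$ of a nonempty (finite or infinite) interval of $\mathbb Z$ under an isometric map; it is a geodesic segment if the interval is finite. For $A,Y\subseteq G$ let $\pi_A(Y)$ be the set of all $a\in A$ for which there is $y\in Y$ with $d(y,a)=d(y,A)$. For $D>0$, a geodesic $\gamma$ is $D$-contracting if $\operatorname{diam}\pi_\gamma(\kappa)<D$ for every geodesic $\kappa$ with $d(\gamma,\kappa)>D$. An element $g\in G$ is contracting if, for some $D>0$, there is an infinite $D$-contracting geodesic at finite Hausdorff distance from $\{g^i : i\in\mathbb Z\}$. The group $G$ is hyperbolic if, for some finite generating set, its word metric is Gromov hyperbolic. Then at least one of the following holds: 1. $G$ is hyperbolic, and there exists $D>0$ such that every geodesic is $D$-contracting; 2. $G$ contains no contracting element; 3. $G$ is not hyperbolic and contains a contracting element, and for every $D>0$ there exists a geodesic segment that is not $D$-contracting. Moreover, whenever $G$ is hyperbolic (whether or not it contains a contracting element), there exists $D>0$ such that every geodesic is $D$-contracting; and conversely, if for some $D>0$ every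 geodesic segment is $D$-contracting, then $G$ is hyperbolic. -/

import Mathlib

/-- `S` is a finite generating set of `G` (finiteness is in the type `Finset G`). -/
def Generates {G : Type*} [Group G] (S : Finset G) : Prop :=
  Subgroup.closure (S : Set G) = ⊤

/-- The word metric on `G` with respect to `S`: the graph distance between vertices of
the Cayley graph `Cay(G, S)`, whose edges join `g` and `g * s` for `s ∈ S`. -/
noncomputable def wordDist {G : Type*} [Group G] (S : Finset G) (x y : G) : ℕ :=
  (SimpleGraph.mulCayley (S : Set G)).dist x y

/-- The Gromov product `(x | y)_w` in the word metric. -/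
noncomputable def gromovProd {G : Type*} [Group G] (S : Finset G) (w x y : G) : ℝ :=
  ((wordDist S w x : ℝ) + wordDist S w y - wordDist S x y) / 2

/-- `(G, d_S)` (equivalently, the Cayley graph) is Gromov hyperbolic. -/
def IsGromovHyperbolic {G : Type*} [Group G] (S : Finset G) : Prop :=
  ∃ δ : ℝ, ∀ w x y z : G,
    min (gromovProd S w x y) (gromovProd S w y z) - δ ≤ gromovProd S w x z

/-- `G` is a hyperbolic group: it has a finite generating set whose word metric is
Gromov hyperbolic. -/
def IsHyperbolicGroup (G : Type*) [Group G] : Prop :=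
  ∃ S : Finset G, Generates S ∧ IsGromovHyperbolic S

/-- `A ⊆ G` is a geodesic (segment, ray or line): the image of a nonempty interval `I` of `ℤ`
under an isometric map into `(G, d_S)`. -/
def IsGeodesic {G : Type*} [Group G] (S : Finset G) (A : Set G) : Prop :=
  ∃ (I : Set ℤ) (f : ℤ → G), I.Nonempty ∧ I.OrdConnected ∧
    (∀ i ∈ I, ∀ j ∈ I, (wordDist S (f i) (f j) : ℤ) = |i - j|) ∧ A = f '' I

/-- `A ⊆ G` is a geodesic segment: the image of an interval `{0, …, n}` under an isometric
map into `(G, d_S)`. -/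
def IsGeodesicSegment {G : Type*} [Group G] (S : Finset G) (A : Set G) : Prop :=
  ∃ (n : ℕ) (f : ℤ → G),
    (∀ i ∈ Set.Icc (0 : ℤ) n, ∀ j ∈ Set.Icc (0 : ℤ) n,
      (wordDist S (f i) (f j) : ℤ) = |i - j|) ∧ A = f '' Set.Icc (0 : ℤ) n

/-- Nearest point projection of a point `y` to `A`: the set of all nearest points. -/
def nearestProj {G : Type*} [Group G] (S : Finset G) (A : Set G) (y : G) : Set G :=
  {a | a ∈ A ∧ ∀ b ∈ A, wordDist S y a ≤ wordDist S y b}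

/-- Nearest point projection of a set `Y` to `A`. -/
def nearestProjSet {G : Type*} [Group G] (S : Finset G) (A Y : Set G) : Set G :=
  ⋃ y ∈ Y, nearestProj S A y

/-- `A` is `D`-contracting: every geodesic `B` with `d(A, B) > D` has a projection to `A` of
diameter less than `D`. As distances are natural numbers, infima of them are attained, and so
are bounded suprema; hence both conditions may be read off from pairs of points. -/
def IsContracting {G : Type*} [Group G] (S : Finset G) (D : ℝ) (A : Set G) : Prop :=
  ∀ B : Set G, IsGeodesic S B →
    (∀ a ∈ A, ∀ b ∈ B, D < (wordDist S a b : ℝ)) →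
    ∀ p ∈ nearestProjSet S A B, ∀ q ∈ nearestProjSet S A B, (wordDist S p q : ℝ) < D

/-- `A` is an axis of `g`: an infinite geodesic at finite Hausdorff distance from the orbit
`{g ^ i | i ∈ ℤ}`. -/
def IsAxis {G : Type*} [Group G] (S : Finset G) (g : G) (A : Set G) : Prop :=
  IsGeodesic S A ∧ A.Infinite ∧ ∃ R : ℕ,
    (∀ a ∈ A, ∃ i : ℤ, wordDist S a (g ^ i) ≤ R) ∧
    (∀ i : ℤ, ∃ a ∈ A, wordDist S a (g ^ i) ≤ R)

/-- `g` is a contracting element: for some `D > 0` it has a `D`-contracting axis. -/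
def IsContractingElement {G : Type*} [Group G] (S : Finset G) (g : G) : Prop :=
  ∃ D : ℝ, 0 < D ∧ ∃ A : Set G, IsAxis S g A ∧ IsContracting S D A

/-!
If geodesic segments are `D`-contracting, triangles are slim: for `m` on a geodesic from `x` to `z`,
project `y` to the part `A` from `x` to `m`. Both `x` and `m` are projections to `A`, of `x` and of
`z`, and a geodesic whose ends have distant projections has to come close to `A`, so that it passes
near these projections. Conversely, in a slim quadrilateral with vertices `y`, `z` and their
projections `p`, `q` to a geodesic, the middle of `[p, q]` can only be near `[y, z]`.

It remains to see that slimness does not depend on the generating set. By the Morse lemma a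
quasi-geodesic and a geodesic with the same ends are uniformly close: iterating the four-point
condition, a path around a ball of radius `K` has a length exponential in `K`, whereas at the
largest distance `K` from the geodesic the detour of a quasi-geodesic has a length linear in `K`.
-/

section GeodesicInterval

variable {V W : Type*} {Γ : SimpleGraph V} {Δ : SimpleGraph W} {m x y : V}

/-- The geodesic interval `[x, y]` of a connected graph: the union of all geodesics from `x` to
`y`. -/
def geodesicInterval (Γ : SimpleGraph V) (x y : V) : Set V :=
  {m | Γ.dist x m + Γ.dist m y = Γ.dist x y}

@[grind =]
theorem mem_geodesicInterval :
    m ∈ geodesicInterval Γ x y ↔ Γ.dist x m + Γ.dist m y = Γ.dist x y :=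
  Iff.rfl

theorem left_mem_geodesicInterval : x ∈ geodesicInterval Γ x y := by
  grind

theorem right_mem_geodesicInterval : y ∈ geodesicInterval Γ x y := by
  grind

theorem geodesicInterval_comm (x y : V) : geodesicInterval Γ x y = geodesicInterval Γ y x := by
  ext m
  grind [SimpleGraph.dist_comm]

theorem geodesicInterval_subset_left (hΓ : Γ.Connected) (hm : m ∈ geodesicInterval Γ x y) :
    geodesicInterval Γ x m ⊆ geodesicInterval Γ x y := by
  intro u hu
  have h₁ : Γ.dist u y ≤ Γ.dist u m + Γ.dist m y := hΓ.dist_triangle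
  have h₂ : Γ.dist x y ≤ Γ.dist x u + Γ.dist u y := hΓ.dist_triangle
  grind

theorem geodesicInterval_subset_right (hΓ : Γ.Connected) (hm : m ∈ geodesicInterval Γ x y) :
    geodesicInterval Γ m y ⊆ geodesicInterval Γ x y := by
  rw [geodesicInterval_comm m y, geodesicInterval_comm x y] at *
  exact geodesicInterval_subset_left hΓ hm

theorem dist_getVert_of_length_eq_dist {p : Γ.Walk x y} (hp : p.length = Γ.dist x y) {i j : ℕ}
    (hij : i ≤ j) (hj : j ≤ p.length) : Γ.dist (p.getVert i) (p.getVert j) = j - i := by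
  have h₁ : (p.take j).length = Γ.dist x (p.getVert j) :=
    SimpleGraph.length_eq_dist_of_subwalk hp (p.isSubwalk_take j)
  have h₂ := SimpleGraph.length_eq_dist_of_subwalk h₁ ((p.take j).isSubwalk_drop i)
  rw [SimpleGraph.Walk.drop_length, SimpleGraph.Walk.take_length, SimpleGraph.Walk.take_getVert,
    min_eq_left hj, min_eq_right hij] at h₂
  exact h₂.symm

theorem getVert_mem_geodesicInterval {p : Γ.Walk x y} (hp : p.length = Γ.dist x y) {i : ℕ}
    (hi : i ≤ p.length) : p.getVert i ∈ geodesicInterval Γ x y := by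
  have h₁ := dist_getVert_of_length_eq_dist hp (Nat.zero_le i) hi
  have h₂ := dist_getVert_of_length_eq_dist hp hi le_rfl
  rw [p.getVert_zero] at h₁
  rw [p.getVert_length] at h₂
  grind

theorem exists_walk_length_eq_dist_getVert_eq (hΓ : Γ.Connected)
    (hm : m ∈ geodesicInterval Γ x y) :
    ∃ p : Γ.Walk x y, p.length = Γ.dist x y ∧ p.getVert (Γ.dist x m) = m := by
  obtain ⟨p, hp⟩ := hΓ.exists_walk_length_eq_dist x m
  obtain ⟨q, hq⟩ := hΓ.exists_walk_length_eq_dist m y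
  refine ⟨p.append q, ?_, ?_⟩
  · rw [SimpleGraph.Walk.length_append, hp, hq, hm]
  · rw [SimpleGraph.Walk.getVert_append, hp, if_neg (lt_irrefl _), Nat.sub_self, q.getVert_zero]

theorem exists_mem_geodesicInterval_dist_eq (hΓ : Γ.Connected) {t : ℕ} (ht : t ≤ Γ.dist x y) :
    ∃ m ∈ geodesicInterval Γ x y, Γ.dist x m = t := by
  obtain ⟨p, hp⟩ := hΓ.exists_walk_length_eq_dist x y
  have h := dist_getVert_of_length_eq_dist hp (Nat.zero_le t) (ht.trans_eq hp.symm)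
  rw [p.getVert_zero] at h
  exact ⟨p.getVert t, getVert_mem_geodesicInterval hp (ht.trans_eq hp.symm), h⟩

theorem exists_dist_le_one_of_geodesicInterval_subset_union (hΓ : Γ.Connected) {P Q : Set V}
    (hx : x ∈ P) (hy : y ∈ Q) (h : geodesicInterval Γ x y ⊆ P ∪ Q) :
    ∃ p ∈ geodesicInterval Γ x y ∩ P, ∃ q ∈ Q, Γ.dist p q ≤ 1 := by
  induction hd : Γ.dist x y generalizing x with
  | zero =>
    obtain rfl : x = y := hΓ.dist_eq_zero_iff.1 hd
    exact ⟨x, ⟨left_mem_geodesicInterval, hx⟩, x, hy, by simp⟩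
  | succ d ih =>
    obtain ⟨x', hx', hxx'⟩ :=
      exists_mem_geodesicInterval_dist_eq hΓ (x := x) (y := y) (t := 1) (by omega)
    have hsub := geodesicInterval_subset_right hΓ hx'
    rcases h hx' with hP | hQ
    · obtain ⟨p, hp, hq⟩ := ih hP (hsub.trans h) (by grind)
      exact ⟨p, ⟨hsub hp.1, hp.2⟩, hq⟩
    · exact ⟨x, ⟨left_mem_geodesicInterval, hx⟩, x', hQ, hxx'.le⟩

theorem dist_map_le_mul_dist (hΓ : Γ.Connected) (hΔ : Δ.Connected) {φ : V → W} {M : ℕ}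
    (h : ∀ u v, Γ.Adj u v → Δ.dist (φ u) (φ v) ≤ M) (x y : V) :
    Δ.dist (φ x) (φ y) ≤ M * Γ.dist x y := by
  obtain ⟨p, hp⟩ := hΓ.exists_walk_length_eq_dist x y
  rw [← hp]
  clear hp
  induction p with
  | nil => simp
  | @cons u v w huv p ih =>
    calc Δ.dist (φ u) (φ w) ≤ Δ.dist (φ u) (φ v) + Δ.dist (φ v) (φ w) := hΔ.dist_triangle
      _ ≤ M + M * p.length := add_le_add (h u v huv) ih
      _ = M * (SimpleGraph.Walk.cons huv p).length := by
        rw [SimpleGraph.Walk.length_cons]; ring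

end GeodesicInterval

section Slim

variable {V : Type*} {Γ : SimpleGraph V} {η δ : ℕ}

/-- Geodesic triangles are `η`-slim. The sides are replaced by geodesic intervals, so that no
geodesics need to be chosen; `IsSlim.dist_le_two_mul` recovers the version for chosen sides. -/
def IsSlim (Γ : SimpleGraph V) (η : ℕ) : Prop :=
  ∀ x y z, ∀ m ∈ geodesicInterval Γ x z,
    ∃ u ∈ geodesicInterval Γ x y ∪ geodesicInterval Γ y z, Γ.dist m u ≤ η

/-- Gromov's four-point condition, written without Gromov products. The constant is twice the
one in the inequality `(x | z)_w ≥ min (x | y)_w (y | z)_w - δ`. -/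
def IsFourPoint (Γ : SimpleGraph V) (δ : ℕ) : Prop :=
  ∀ w x y z, Γ.dist w y + Γ.dist x z ≤
    max (Γ.dist w z + Γ.dist x y) (Γ.dist w x + Γ.dist y z) + δ

theorem IsSlim.exists_two_mul_dist_le (h : IsSlim Γ η) (hΓ : Γ.Connected) (w x z : V) :
    ∃ m ∈ geodesicInterval Γ x z,
      2 * Γ.dist w m + Γ.dist x z ≤ Γ.dist w x + Γ.dist w z + (4 * η + 2) := by
  obtain ⟨m, ⟨hm, u, hu, hmu⟩, q, ⟨v, hv, hqv⟩, hmq⟩ :=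
    exists_dist_le_one_of_geodesicInterval_subset_union hΓ (x := x) (y := z)
      (P := {m | ∃ u ∈ geodesicInterval Γ x w, Γ.dist m u ≤ η})
      (Q := {m | ∃ v ∈ geodesicInterval Γ w z, Γ.dist m v ≤ η})
      ⟨x, left_mem_geodesicInterval, by simp⟩ ⟨z, right_mem_geodesicInterval, by simp⟩
      (fun m hm => by
        obtain ⟨u, hu | hu, hmu⟩ := h x w z m hm
        exacts [Or.inl ⟨u, hu, hmu⟩, Or.inr ⟨u, hu, hmu⟩])
  have hmv : Γ.dist m v ≤ η + 1 := by
    have : Γ.dist m v ≤ Γ.dist m q + Γ.dist q v := hΓ.dist_triangle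
    omega
  have h₁ : Γ.dist w m ≤ Γ.dist w u + Γ.dist u m := hΓ.dist_triangle
  have h₂ : Γ.dist x m ≤ Γ.dist x u + Γ.dist u m := hΓ.dist_triangle
  have h₃ : Γ.dist w m ≤ Γ.dist w v + Γ.dist v m := hΓ.dist_triangle
  have h₄ : Γ.dist m z ≤ Γ.dist m v + Γ.dist v z := hΓ.dist_triangle
  exact ⟨m, hm, by grind [SimpleGraph.dist_comm]⟩

theorem dist_add_dist_le_of_mem_geodesicInterval (hΓ : Γ.Connected) {x y m : V}
    (hm : m ∈ geodesicInterval Γ x y) (w : V) :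
    Γ.dist w x + Γ.dist w y ≤ 2 * Γ.dist w m + Γ.dist x y := by
  have h₁ : Γ.dist w x ≤ Γ.dist w m + Γ.dist m x := hΓ.dist_triangle
  have h₂ : Γ.dist w y ≤ Γ.dist w m + Γ.dist m y := hΓ.dist_triangle
  grind [SimpleGraph.dist_comm]

theorem IsSlim.isFourPoint (h : IsSlim Γ η) (hΓ : Γ.Connected) :
    IsFourPoint Γ (6 * η + 2) := by
  intro w x y z
  obtain ⟨m, hm, hwm⟩ := h.exists_two_mul_dist_le hΓ w x z
  obtain ⟨u, hu, hmu⟩ := h x y z m hm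
  have hwu : Γ.dist w u ≤ Γ.dist w m + Γ.dist m u := hΓ.dist_triangle
  rcases hu with hu | hu <;>
  · have := dist_add_dist_le_of_mem_geodesicInterval hΓ hu w
    omega

theorem IsFourPoint.exists_two_mul_dist_le (h : IsFourPoint Γ δ) (hΓ : Γ.Connected) (w x y : V) :
    ∃ m ∈ geodesicInterval Γ x y,
      2 * Γ.dist w m + Γ.dist x y ≤ Γ.dist w x + Γ.dist w y + (2 * δ + 1) := by
  have h₁ : Γ.dist w x ≤ Γ.dist w y + Γ.dist y x := hΓ.dist_triangle
  have h₂ : Γ.dist w y ≤ Γ.dist w x + Γ.dist x y := hΓ.dist_triangle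
  have hyx : Γ.dist y x = Γ.dist x y := SimpleGraph.dist_comm
  -- At this distance from `x` the two terms of the maximum below differ by at most one.
  obtain ⟨m, hm, hxm⟩ := exists_mem_geodesicInterval_dist_eq hΓ (x := x) (y := y)
    (t := (Γ.dist w x + Γ.dist x y - Γ.dist w y) / 2) (by omega)
  have h₃ := h m x w y
  exact ⟨m, hm, by grind [SimpleGraph.dist_comm]⟩

theorem IsFourPoint.isSlim (h : IsFourPoint Γ δ) (hΓ : Γ.Connected) : IsSlim Γ (2 * δ) := by
  intro x y z m hm
  obtain ⟨u, hu, hmu⟩ := h.exists_two_mul_dist_le hΓ m x y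
  obtain ⟨v, hv, hmv⟩ := h.exists_two_mul_dist_le hΓ m y z
  have h₁ := h m x y z
  have hxm : Γ.dist x m = Γ.dist m x := SimpleGraph.dist_comm
  have hm : Γ.dist x m + Γ.dist m z = Γ.dist x z := hm
  rcases le_total (Γ.dist m z + Γ.dist x y) (Γ.dist m x + Γ.dist y z) with hle | hle
  · exact ⟨v, Or.inr hv, by omega⟩
  · exact ⟨u, Or.inl hu, by omega⟩

theorem IsSlim.dist_le_two_mul (h : IsSlim Γ η) (hΓ : Γ.Connected) {x y m m' : V}
    (hm : m ∈ geodesicInterval Γ x y) (hm' : m' ∈ geodesicInterval Γ x y)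
    (heq : Γ.dist x m = Γ.dist x m') : Γ.dist m m' ≤ 2 * η := by
  obtain ⟨u, hu, hmu⟩ := h x m' y m hm
  have h₁ : Γ.dist m m' ≤ Γ.dist m u + Γ.dist u m' := hΓ.dist_triangle
  have h₂ : Γ.dist x m ≤ Γ.dist x u + Γ.dist u m := hΓ.dist_triangle
  have h₃ : Γ.dist m y ≤ Γ.dist m u + Γ.dist u y := hΓ.dist_triangle
  rcases hu with hu | hu <;> grind [SimpleGraph.dist_comm]

theorem IsSlim.exists_dist_le_of_quadrilateral (h : IsSlim Γ η) (hΓ : Γ.Connected)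
    {p q y z m : V} (hm : m ∈ geodesicInterval Γ p q) (hp : Γ.dist y p ≤ Γ.dist y m)
    (hq : Γ.dist z q ≤ Γ.dist z m) :
    (∃ b ∈ geodesicInterval Γ y z, Γ.dist m b ≤ 2 * η) ∨
      Γ.dist p m ≤ 4 * η ∨ Γ.dist m q ≤ 4 * η := by
  have near_corner {a c u : V} (hu : u ∈ geodesicInterval Γ a c) (hmu : Γ.dist m u ≤ 2 * η)
      (hc : Γ.dist a c ≤ Γ.dist a m) : Γ.dist m c ≤ 4 * η := by
    have h₁ : Γ.dist a m ≤ Γ.dist a u + Γ.dist u m := hΓ.dist_triangle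
    have h₂ : Γ.dist m c ≤ Γ.dist m u + Γ.dist u c := hΓ.dist_triangle
    grind [SimpleGraph.dist_comm]
  obtain ⟨u, hu | hu, hmu⟩ := h p z q m hm
  · obtain ⟨v, hv, huv⟩ := h p y z u hu
    have hmv : Γ.dist m v ≤ 2 * η := by
      have : Γ.dist m v ≤ Γ.dist m u + Γ.dist u v := hΓ.dist_triangle
      omega
    rcases hv with hv | hv
    · rw [geodesicInterval_comm] at hv
      rw [SimpleGraph.dist_comm (u := p)]
      exact Or.inr (Or.inl (near_corner hv hmv hp))
    · exact Or.inl ⟨v, hv, hmv⟩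
  · exact Or.inr (Or.inr (near_corner hu (by omega) hq))

end Slim

section Morse

variable {V W : Type*} {Γ : SimpleGraph V} {Δ : SimpleGraph W} {δ M Λ L : ℕ} {α : ℕ → V}

/-- The points `α 0, …, α L` form a quasi-geodesic with multiplicative constants `M` and `Λ`. The
upper bound on distances is only required for consecutive points. -/
structure IsQuasiGeodesic (Γ : SimpleGraph V) (M Λ L : ℕ) (α : ℕ → V) : Prop where
  dist_succ_le : ∀ i < L, Γ.dist (α i) (α (i + 1)) ≤ M
  sub_le_mul_dist : ∀ i j, i ≤ j → j ≤ L → j - i ≤ Λ * Γ.dist (α i) (α j)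

theorem IsQuasiGeodesic.dist_le (hα : IsQuasiGeodesic Γ M Λ L α) (hΓ : Γ.Connected) {i j : ℕ}
    (hij : i ≤ j) (hj : j ≤ L) : Γ.dist (α i) (α j) ≤ M * (j - i) := by
  induction j, hij using Nat.le_induction with
  | base => simp
  | succ j hij ih =>
    calc Γ.dist (α i) (α (j + 1)) ≤ Γ.dist (α i) (α j) + Γ.dist (α j) (α (j + 1)) :=
          hΓ.dist_triangle
      _ ≤ M * (j - i) + M := add_le_add (ih (by omega)) (hα.dist_succ_le j hj)
      _ = M * (j + 1 - i) := by rw [Nat.succ_sub hij, Nat.mul_succ]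

/-- The four-point condition is iterated along a binary tree of depth `n`. This bounds the Gromov
product of `α i` and `α j` at `p` from below by `K - (M + n * δ) / 2`. -/
theorem IsFourPoint.two_mul_add_dist_le_of_le_dist (h : IsFourPoint Γ δ) {p : V} {K n i j : ℕ}
    (hM : ∀ k, i ≤ k → k < j → Γ.dist (α k) (α (k + 1)) ≤ M)
    (hK : ∀ k, i ≤ k → k ≤ j → K ≤ Γ.dist p (α k)) (hij : i ≤ j) (hj : j ≤ i + 2 ^ n) :
    2 * K + Γ.dist (α i) (α j) ≤ Γ.dist p (α i) + Γ.dist p (α j) + M + n * δ := by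
  induction n generalizing i j with
  | zero =>
    have hi := hK i le_rfl hij
    have hj' := hK j hij le_rfl
    obtain rfl | rfl : j = i ∨ j = i + 1 := by omega
    · rw [SimpleGraph.dist_self]
      omega
    · have := hM i le_rfl (Nat.lt_succ_self i)
      omega
  | succ n ih =>
    rw [pow_succ] at hj
    rw [add_mul, one_mul]
    obtain ⟨m, him, hmj, hm, hjm⟩ : ∃ m, i ≤ m ∧ m ≤ j ∧ m ≤ i + 2 ^ n ∧ j ≤ m + 2 ^ n :=
      ⟨min j (i + 2 ^ n), by omega, by omega, by omega, by omega⟩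
    have h₁ := ih (fun k hk hk' => hM k hk (by omega)) (fun k hk hk' => hK k hk (by omega)) him hm
    have h₂ := ih (fun k hk hk' => hM k (by omega) hk') (fun k hk hk' => hK k (by omega) hk')
      hmj hjm
    have h₃ := h p (α i) (α m) (α j)
    omega

theorem exists_forall_add_mul_le_two_pow (a b : ℕ) : ∃ n₀, ∀ n ≥ n₀, a + b * n ≤ 2 ^ n := by
  have hε : (0 : ℝ) < 1 / (a + b + 1) := by positivity
  have ho := (isLittleO_coe_const_pow_of_one_lt (R := ℝ) one_lt_two).bound hε
  obtain ⟨n₀, hn₀⟩ := Filter.eventually_atTop.1 ho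
  refine ⟨max n₀ 1, fun n hn => ?_⟩
  have hn' := hn₀ n (le_of_max_le_left hn)
  rw [Real.norm_natCast, norm_pow, Real.norm_ofNat, one_div, ← div_eq_inv_mul,
    le_div_iff₀ (by positivity)] at hn'
  have hcast : n * (a + b + 1) ≤ 2 ^ n := by exact_mod_cast hn'
  have hn1 : 1 ≤ n := le_of_max_le_right hn
  nlinarith

/-- In terms of logarithms, the condition on `K` is `K ≤ a + b * ⌈log₂ (c * K)⌉`. -/
theorem exists_bound_of_forall_le_two_pow (a b c : ℕ) :
    ∃ B, ∀ K, (∀ n, c * K ≤ 2 ^ n → K ≤ a + b * n) → K ≤ B := by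
  obtain ⟨n₀, hn₀⟩ := exists_forall_add_mul_le_two_pow (c * (a + b)) (c * b)
  refine ⟨a + b * n₀, fun K hK => hK n₀ ?_⟩
  have descend : ∀ n ≥ n₀, c * K ≤ 2 ^ (n + 1) → c * K ≤ 2 ^ n := fun n hn h =>
    calc c * K ≤ c * (a + b * (n + 1)) := Nat.mul_le_mul_left c (hK (n + 1) h)
      _ = c * (a + b) + c * b * n := by ring
      _ ≤ 2 ^ n := hn₀ n hn
  have hlarge : c * K ≤ 2 ^ max n₀ (c * K) :=
    (le_max_right _ _).trans Nat.lt_two_pow_self.le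
  exact Nat.decreasingInduction' (P := fun n => c * K ≤ 2 ^ n)
    (fun n _ hn => descend n hn) (le_max_left _ _) hlarge

/-- The point `u` lies at distance `2 * K` from `p`, unless already `α k` is closer than that.
The last inequality implies that no geodesic from `u` to `α i` enters the ball of radius `K` around
`p`. -/
theorem exists_two_mul_add_dist_le_of_forall_exists_dist_le (hΓ : Γ.Connected) {p : V} {K k : ℕ}
    (hk : k ≤ L) (hpα : ∀ i ≤ L, K ≤ Γ.dist p (α i))
    (hK : ∀ u ∈ geodesicInterval Γ (α k) p, ∃ i ≤ L, Γ.dist u (α i) ≤ K) :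
    ∃ u ∈ geodesicInterval Γ (α k) p, ∃ i ≤ L, Γ.dist u (α i) ≤ K ∧ Γ.dist u p ≤ 2 * K ∧
      2 * K + Γ.dist u (α i) ≤ Γ.dist p u + Γ.dist p (α i) := by
  rcases le_total (2 * K) (Γ.dist (α k) p) with hle | hle
  · obtain ⟨u, hu, hxu⟩ := exists_mem_geodesicInterval_dist_eq hΓ
      (x := α k) (y := p) (t := Γ.dist (α k) p - 2 * K) (by omega)
    obtain ⟨i, hi, hui⟩ := hK u hu
    have hpi := hpα i hi
    exact ⟨u, hu, i, hi, hui, by grind, by grind [SimpleGraph.dist_comm]⟩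
  · have hpk := hpα k hk
    exact ⟨α k, left_mem_geodesicInterval, k, hk, by simp, hle, by
      rw [SimpleGraph.dist_self]
      omega⟩

theorem IsFourPoint.two_mul_add_dist_le_of_isQuasiGeodesic (h : IsFourPoint Γ δ)
    (hα : IsQuasiGeodesic Γ M Λ L α) {p : V} {K n i j : ℕ} (hK : ∀ k ≤ L, K ≤ Γ.dist p (α k))
    (hi : i ≤ L) (hj : j ≤ L) (hn : Λ * Γ.dist (α i) (α j) ≤ 2 ^ n) :
    2 * K + Γ.dist (α i) (α j) ≤ Γ.dist p (α i) + Γ.dist p (α j) + M + n * δ := by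
  wlog hij : i ≤ j generalizing i j
  · rw [SimpleGraph.dist_comm] at hn ⊢
    have := this hj hi hn (by omega)
    omega
  have hsub := hα.sub_le_mul_dist i j hij hj
  exact h.two_mul_add_dist_le_of_le_dist (fun k _ hk => hα.dist_succ_le k (by omega))
    (fun k _ hk => hK k (by omega)) hij (by omega)

theorem IsFourPoint.two_mul_le_of_forall_exists_dist_le (h : IsFourPoint Γ δ) (hΓ : Γ.Connected)
    (hα : IsQuasiGeodesic Γ M Λ L α) {p : V} {K n : ℕ}
    (hp : p ∈ geodesicInterval Γ (α 0) (α L)) (hpα : ∀ i ≤ L, K ≤ Γ.dist p (α i))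
    (hK : ∀ u ∈ geodesicInterval Γ (α 0) (α L), ∃ i ≤ L, Γ.dist u (α i) ≤ K)
    (hn : Λ * (6 * K) ≤ 2 ^ n) : 2 * K ≤ M + n * δ + 2 * δ := by
  obtain ⟨u, hu, i, hi, hui, hup, hpui⟩ := exists_two_mul_add_dist_le_of_forall_exists_dist_le hΓ
    (Nat.zero_le L) hpα fun u hu => hK u (geodesicInterval_subset_left hΓ hp hu)
  obtain ⟨v, hv, j, hj, hvj, hvp, hpvj⟩ := exists_two_mul_add_dist_le_of_forall_exists_dist_le hΓ
    le_rfl hpα fun v hv => hK v (geodesicInterval_subset_right hΓ hp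
      (by rwa [geodesicInterval_comm]))
  rw [mem_geodesicInterval] at hp hu hv
  have comm (a b : V) : Γ.dist a b = Γ.dist b a := SimpleGraph.dist_comm
  have triangle (a b c : V) : Γ.dist a c ≤ Γ.dist a b + Γ.dist b c := hΓ.dist_triangle
  rw [comm u (α i)] at hui hpui
  rw [comm u p] at hup hu
  rw [comm v p] at hvp hv
  have hupv : Γ.dist p u + Γ.dist p v ≤ Γ.dist u v := by
    have h₁ := triangle (α 0) u (α L)
    have h₂ := triangle u v (α L)
    have h₃ := comm v (α L)
    have h₄ := comm p (α L)
    omega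
  have hij : Γ.dist (α i) (α j) ≤ 6 * K := by
    have h₁ := triangle (α i) u (α j)
    have h₂ := triangle u p (α j)
    have h₃ := triangle p v (α j)
    have h₄ := comm u p
    omega
  have hpath := h.two_mul_add_dist_le_of_isQuasiGeodesic hα hpα hi hj
    ((Nat.mul_le_mul_left Λ hij).trans hn)
  have h₁ := h p u (α i) v
  have h₂ := h p (α i) (α j) v
  have h₃ := comm u (α i)
  have h₄ := comm (α j) v
  omega

theorem IsFourPoint.exists_dist_quasiGeodesic_le (h : IsFourPoint Γ δ) (hΓ : Γ.Connected)
    (M Λ : ℕ) : ∃ K, ∀ L α, IsQuasiGeodesic Γ M Λ L α →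
      ∀ p ∈ geodesicInterval Γ (α 0) (α L), ∃ i ≤ L, Γ.dist p (α i) ≤ K := by
  obtain ⟨B, hB⟩ := exists_bound_of_forall_le_two_pow (M + 2 * δ) δ (Λ * 6)
  refine ⟨B, fun L α hα => ?_⟩
  classical
  have hex : ∃ K, ∀ p ∈ geodesicInterval Γ (α 0) (α L), ∃ i ≤ L, Γ.dist p (α i) ≤ K :=
    ⟨Γ.dist (α 0) (α L), fun p hp => ⟨0, Nat.zero_le L, by grind [SimpleGraph.dist_comm]⟩⟩
  obtain ⟨K, hK, hmin⟩ : ∃ K, (∀ p ∈ geodesicInterval Γ (α 0) (α L),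
      ∃ i ≤ L, Γ.dist p (α i) ≤ K) ∧ ∀ K' < K, ∃ p ∈ geodesicInterval Γ (α 0) (α L),
      ∀ i ≤ L, K' < Γ.dist p (α i) :=
    ⟨Nat.find hex, Nat.find_spec hex, fun K' hK' => by simpa using Nat.find_min hex hK'⟩
  have hKB : K ≤ B := hB K fun n hn => by
    rcases Nat.eq_zero_or_pos K with rfl | hpos
    · exact Nat.zero_le _
    obtain ⟨p, hp, hpα⟩ := hmin (K - 1) (by omega)
    have := h.two_mul_le_of_forall_exists_dist_le hΓ hα hp
      (fun i hi => by have := hpα i hi; omega) hK (n := n) (by rwa [← mul_assoc])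
    rw [mul_comm δ n]
    omega
  intro p hp
  obtain ⟨i, hi, hpi⟩ := hK p hp
  exact ⟨i, hi, hpi.trans hKB⟩

theorem IsQuasiGeodesic.exists_mem_geodesicInterval_dist_le (hα : IsQuasiGeodesic Γ M Λ L α)
    (hΓ : Γ.Connected) {K k : ℕ}
    (hK : ∀ p ∈ geodesicInterval Γ (α 0) (α L), ∃ i ≤ L, Γ.dist p (α i) ≤ K) (hk : k ≤ L) :
    ∃ p ∈ geodesicInterval Γ (α 0) (α L),
      Γ.dist (α k) p ≤ M * (Λ * (2 * K + 1)) + K := by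
  obtain ⟨p, ⟨hp, i, hik, hpi⟩, q, ⟨j, hkj, hj, hqj⟩, hpq⟩ :=
    exists_dist_le_one_of_geodesicInterval_subset_union hΓ (x := α 0) (y := α L)
      (P := {p | ∃ i ≤ k, Γ.dist p (α i) ≤ K})
      (Q := {q | ∃ j, k ≤ j ∧ j ≤ L ∧ Γ.dist q (α j) ≤ K})
      ⟨0, Nat.zero_le k, by simp⟩ ⟨L, hk, le_rfl, by simp⟩
      (fun p hp => by
        obtain ⟨i, hi, hpi⟩ := hK p hp
        rcases le_total i k with hik | hki
        exacts [Or.inl ⟨i, hik, hpi⟩, Or.inr ⟨i, hki, hi, hpi⟩])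
  have hij : Γ.dist (α i) (α j) ≤ 2 * K + 1 := by
    have h₁ : Γ.dist (α i) (α j) ≤ Γ.dist (α i) p + Γ.dist p (α j) := hΓ.dist_triangle
    have h₂ : Γ.dist p (α j) ≤ Γ.dist p q + Γ.dist q (α j) := hΓ.dist_triangle
    grind [SimpleGraph.dist_comm]
  have hki : k - i ≤ Λ * (2 * K + 1) :=
    calc k - i ≤ j - i := Nat.sub_le_sub_right hkj i
      _ ≤ Λ * Γ.dist (α i) (α j) := hα.sub_le_mul_dist i j (hik.trans hkj) hj
      _ ≤ Λ * (2 * K + 1) := Nat.mul_le_mul_left Λ hij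
  refine ⟨p, hp, ?_⟩
  calc Γ.dist (α k) p ≤ Γ.dist (α k) (α i) + Γ.dist (α i) p := hΓ.dist_triangle
    _ = Γ.dist (α i) (α k) + Γ.dist p (α i) := by
      rw [Γ.dist_comm (u := α k), Γ.dist_comm (u := α i) (v := p)]
    _ ≤ M * (Λ * (2 * K + 1)) + K :=
      add_le_add ((hα.dist_le hΓ hik hk).trans (Nat.mul_le_mul_left M hki)) hpi

/-- A bi-Lipschitz embedding of the vertex sets, with separate constants for the two bounds. The
identity of a group is one between any two of its Cayley graphs. -/
structure IsBiLipschitz (Γ : SimpleGraph V) (Δ : SimpleGraph W) (M Λ : ℕ) (φ : V → W) : Prop where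
  dist_map_le : ∀ u v, Δ.dist (φ u) (φ v) ≤ M * Γ.dist u v
  dist_le_mul : ∀ u v, Γ.dist u v ≤ Λ * Δ.dist (φ u) (φ v)

theorem IsBiLipschitz.isQuasiGeodesic {φ : V → W} (hφ : IsBiLipschitz Γ Δ M Λ φ) {x y : V}
    {p : Γ.Walk x y} (hp : p.length = Γ.dist x y) :
    IsQuasiGeodesic Δ M Λ p.length (φ ∘ p.getVert) where
  dist_succ_le i hi := by
    have h := dist_getVert_of_length_eq_dist hp (Nat.le_succ i) hi
    simpa [h] using hφ.dist_map_le (p.getVert i) (p.getVert (i + 1))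
  sub_le_mul_dist i j hij hj := by
    rw [← dist_getVert_of_length_eq_dist hp hij hj]
    exact hφ.dist_le_mul _ _

theorem IsFourPoint.exists_mem_geodesicInterval_dist_map_le {Δ : SimpleGraph W}
    (h : IsFourPoint Δ δ) (hΓ : Γ.Connected) (hΔ : Δ.Connected) {φ : V → W}
    (hφ : IsBiLipschitz Γ Δ M Λ φ) :
    ∃ K, ∀ x y,
      (∀ u ∈ geodesicInterval Δ (φ x) (φ y),
        ∃ m ∈ geodesicInterval Γ x y, Δ.dist u (φ m) ≤ K) ∧
      ∀ m ∈ geodesicInterval Γ x y,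
        ∃ u ∈ geodesicInterval Δ (φ x) (φ y), Δ.dist (φ m) u ≤ K := by
  obtain ⟨K, hK⟩ := h.exists_dist_quasiGeodesic_le hΔ M Λ
  have near {x y : V} {p : Γ.Walk x y} (hp : p.length = Γ.dist x y) :
      ∀ u ∈ geodesicInterval Δ (φ x) (φ y), ∃ i ≤ p.length, Δ.dist u (φ (p.getVert i)) ≤ K := by
    simpa using hK _ _ (hφ.isQuasiGeodesic hp)
  refine ⟨M * (Λ * (2 * K + 1)) + K, fun x y => ⟨fun u hu => ?_, fun m hm => ?_⟩⟩
  · obtain ⟨p, hp⟩ := hΓ.exists_walk_length_eq_dist x y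
    obtain ⟨i, hi, hui⟩ := near hp u hu
    exact ⟨p.getVert i, getVert_mem_geodesicInterval hp hi, by omega⟩
  · obtain ⟨p, hp, hpm⟩ := exists_walk_length_eq_dist_getVert_eq hΓ hm
    have hle : Γ.dist x m ≤ p.length := by grind
    simpa [hpm] using (hφ.isQuasiGeodesic hp).exists_mem_geodesicInterval_dist_le hΔ
      (by simpa using near hp) hle

theorem IsFourPoint.exists_isSlim_of_isBiLipschitz {Δ : SimpleGraph W} (h : IsFourPoint Δ δ)
    (hΓ : Γ.Connected) (hΔ : Δ.Connected) {φ : V → W} (hφ : IsBiLipschitz Γ Δ M Λ φ) :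
    ∃ η, IsSlim Γ η := by
  obtain ⟨K, hK⟩ := h.exists_mem_geodesicInterval_dist_map_le hΓ hΔ hφ
  refine ⟨Λ * (K + 2 * δ + K), fun x y z m hm => ?_⟩
  obtain ⟨v, hv, hmv⟩ := (hK x z).2 m hm
  obtain ⟨w, hw, hvw⟩ := h.isSlim hΔ (φ x) (φ y) (φ z) v hv
  obtain ⟨u, hu, hwu⟩ : ∃ u ∈ geodesicInterval Γ x y ∪ geodesicInterval Γ y z,
      Δ.dist w (φ u) ≤ K := by
    rcases hw with hw | hw
    · obtain ⟨u, hu, hwu⟩ := (hK x y).1 w hw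
      exact ⟨u, Or.inl hu, hwu⟩
    · obtain ⟨u, hu, hwu⟩ := (hK y z).1 w hw
      exact ⟨u, Or.inr hu, hwu⟩
  refine ⟨u, hu, (hφ.dist_le_mul m u).trans (Nat.mul_le_mul_left Λ ?_)⟩
  calc Δ.dist (φ m) (φ u) ≤ Δ.dist (φ m) v + Δ.dist v (φ u) := hΔ.dist_triangle
    _ ≤ Δ.dist (φ m) v + (Δ.dist v w + Δ.dist w (φ u)) :=
      Nat.add_le_add_left hΔ.dist_triangle _
    _ ≤ K + 2 * δ + K := by omega

end Morse

section WordMetric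

open SimpleGraph (mulCayley)

variable {G : Type*} [Group G] {S T : Finset G}

theorem reachable_mulCayley_mul (x : G) {g : G} (hg : g ∈ Subgroup.closure (S : Set G)) :
    (mulCayley (S : Set G)).Reachable x (x * g) := by
  induction hg using Subgroup.closure_induction generalizing x with
  | mem s hs =>
    by_cases h : x = x * s
    · rw [← h]
    · exact ((SimpleGraph.mulCayley_adj' _ _ _).2 ⟨h, s, hs, Or.inl rfl⟩).reachable
  | one => rw [mul_one]
  | mul g h _ _ ihg ihh => exact mul_assoc x g h ▸ (ihg x).trans (ihh (x * g))
  | inv g _ ih => simpa using (ih (x * g⁻¹)).symm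

theorem Generates.connected (hS : Generates S) : (mulCayley (S : Set G)).Connected := by
  have : Nonempty G := ⟨1⟩
  refine ⟨fun x y => ?_⟩
  simpa using reachable_mulCayley_mul x (g := x⁻¹ * y) (hS ▸ Subgroup.mem_top (x⁻¹ * y))

theorem wordDist_comm (x y : G) : wordDist S x y = wordDist S y x :=
  SimpleGraph.dist_comm

theorem Generates.wordDist_mul_left_le (hS : Generates S) (g x y : G) :
    wordDist S (g * x) (g * y) ≤ wordDist S x y := by
  have h := dist_map_le_mul_dist hS.connected hS.connected (φ := (g * ·)) (M := 1)
    (fun u v huv => (SimpleGraph.dist_eq_one_iff_adj.2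
      (SimpleGraph.mulCayley_adj_mul_iff_right.2 huv)).le) x y
  rwa [one_mul] at h

theorem Generates.exists_wordDist_le_mul (hS : Generates S) (hT : Generates T) :
    ∃ M, ∀ x y, wordDist T x y ≤ M * wordDist S x y := by
  set M := S.sup (wordDist T 1)
  have hmul (u s : G) (hs : s ∈ S) : wordDist T u (u * s) ≤ M := by
    have h := hT.wordDist_mul_left_le u 1 s
    rw [mul_one] at h
    exact h.trans (Finset.le_sup (f := wordDist T 1) hs)
  refine ⟨M, dist_map_le_mul_dist hS.connected hT.connected (φ := id) fun u v huv => ?_⟩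
  obtain ⟨-, s, hs, rfl | rfl⟩ := (SimpleGraph.mulCayley_adj' _ _ _).1 huv
  · exact hmul u s hs
  · exact (wordDist_comm _ _).trans_le (hmul v s hs)

theorem exists_isBiLipschitz_id (hS : Generates S) (hT : Generates T) :
    ∃ M Λ, IsBiLipschitz (mulCayley (S : Set G)) (mulCayley (T : Set G)) M Λ id := by
  obtain ⟨M, hM⟩ := hS.exists_wordDist_le_mul hT
  obtain ⟨Λ, hΛ⟩ := hT.exists_wordDist_le_mul hS
  exact ⟨M, Λ, hM, hΛ⟩

theorem isGromovHyperbolic_iff_exists_isFourPoint :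
    IsGromovHyperbolic S ↔ ∃ δ, IsFourPoint (mulCayley (S : Set G)) δ := by
  have key (δ : ℕ) (w x y z : G) :
      min (gromovProd S w x y) (gromovProd S w y z) - (δ : ℝ) / 2 ≤ gromovProd S w x z ↔
        wordDist S w y + wordDist S x z ≤
          max (wordDist S w z + wordDist S x y) (wordDist S w x + wordDist S y z) + δ := by
    rw [← Nat.cast_le (α := ℝ)]
    push_cast
    rw [sub_le_iff_le_add, min_le_iff, ← sub_le_iff_le_add (c := (δ : ℝ)), le_max_iff]
    simp only [gromovProd]
    constructor <;> rintro (h | h) <;> first | (left; linarith) | (right; linarith)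
  refine ⟨fun ⟨δ, h⟩ => ⟨⌈2 * δ⌉₊, fun w x y z => (key _ w x y z).1 ?_⟩,
    fun ⟨δ, h⟩ => ⟨δ / 2, fun w x y z => (key δ w x y z).2 (h w x y z)⟩⟩
  have := h w x y z
  have := Nat.le_ceil (2 * δ)
  linarith

end WordMetric

section Contracting

open SimpleGraph (mulCayley)

variable {G : Type*} [Group G] {S : Finset G} {A : Set G} {p q y z : G}

theorem IsGeodesicSegment.isGeodesic (hA : IsGeodesicSegment S A) : IsGeodesic S A := by
  obtain ⟨n, f, hf, rfl⟩ := hA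
  exact ⟨Set.Icc 0 n, f, ⟨0, by simp⟩, Set.ordConnected_Icc, hf, rfl⟩

theorem Generates.exists_isGeodesicSegment (hS : Generates S) (x y : G) :
    ∃ B, IsGeodesicSegment S B ∧ x ∈ B ∧ y ∈ B ∧
      B ⊆ geodesicInterval (mulCayley (S : Set G)) x y := by
  obtain ⟨w, hw⟩ := hS.connected.exists_walk_length_eq_dist x y
  have hdist (i j : ℤ) (hi : 0 ≤ i) (hij : i ≤ j) (hj : j ≤ w.length) :
      (wordDist S (w.getVert i.toNat) (w.getVert j.toNat) : ℤ) = j - i := by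
    rw [wordDist, dist_getVert_of_length_eq_dist hw (by omega) (by omega)]
    omega
  refine ⟨(fun i : ℤ => w.getVert i.toNat) '' Set.Icc (0 : ℤ) w.length,
    ⟨w.length, _, fun i hi j hj => ?_, rfl⟩, ⟨0, by simp⟩, ⟨w.length, by simp⟩, ?_⟩
  · rcases le_total i j with hij | hji
    · rw [hdist i j hi.1 hij hj.2, abs_sub_comm, abs_of_nonneg (sub_nonneg.2 hij)]
    · rw [wordDist_comm, hdist j i hj.1 hji hi.2, abs_of_nonneg (sub_nonneg.2 hji)]
  · rintro _ ⟨i, ⟨-, hi⟩, rfl⟩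
    exact getVert_mem_geodesicInterval hw (by omega)

theorem IsGeodesic.exists_mem_geodesicInterval_wordDist_eq (hA : IsGeodesic S A) (hp : p ∈ A)
    (hq : q ∈ A) {t : ℕ} (ht : t ≤ wordDist S p q) :
    ∃ m ∈ A, m ∈ geodesicInterval (mulCayley (S : Set G)) p q ∧ wordDist S p m = t := by
  obtain ⟨I, f, -, hI, hf, rfl⟩ := hA
  obtain ⟨a, ha, rfl⟩ := hp
  obtain ⟨b, hb, rfl⟩ := hq
  have hab := hf a ha b hb
  simp only [abs_eq_max_neg] at hf hab
  obtain ⟨c, hc, hac, hcb⟩ : ∃ c ∈ Set.uIcc a b, max (a - c) (-(a - c)) = t ∧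
      max (a - c) (-(a - c)) + max (c - b) (-(c - b)) = wordDist S (f a) (f b) := by
    simp only [Set.mem_uIcc]
    rcases le_total a b with h | h
    · exact ⟨a + t, by omega, by omega, by omega⟩
    · exact ⟨a - t, by omega, by omega, by omega⟩
  have hcI : c ∈ I := hI.uIcc_subset ha hb hc
  rw [← hf a ha c hcI] at hac hcb
  rw [← hf c hcI b hb] at hcb
  exact ⟨f c, ⟨c, hcI, rfl⟩, by exact_mod_cast hcb, by exact_mod_cast hac⟩

theorem exists_mem_nearestProj (hA : A.Nonempty) (y : G) : ∃ a, a ∈ nearestProj S A y :=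
  ⟨Function.argminOn (wordDist S y) A hA, Function.argminOn_mem _ A hA,
    fun _ hb => Function.argminOn_le _ A hb⟩

theorem IsContracting.wordDist_lt_of_forall_lt {D : ℝ} {N : ℕ} (hA : IsContracting S D A)
    (hS : Generates S) (hDN : D ≤ N) (hp : p ∈ nearestProj S A y) (hq : q ∈ nearestProj S A z)
    (hfar : ∀ b ∈ geodesicInterval (mulCayley (S : Set G)) y z, ∀ a ∈ A, N < wordDist S a b) :
    wordDist S p q < N := by
  obtain ⟨B, hB, hy, hz, hsub⟩ := hS.exists_isGeodesicSegment y z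
  have h : (wordDist S p q : ℝ) < D := hA B hB.isGeodesic
    (fun a ha b hb => hDN.trans_lt (Nat.cast_lt.2 (hfar b (hsub hb) a ha)))
    p (Set.mem_biUnion hy hp) q (Set.mem_biUnion hz hq)
  exact_mod_cast h.trans_le hDN

theorem IsContracting.exists_wordDist_le {D : ℝ} {N : ℕ} (hA : IsContracting S D A)
    (hS : Generates S) (hDN : D ≤ N) (hp : p ∈ nearestProj S A y) (hq : q ∈ nearestProj S A z)
    (hpq : N ≤ wordDist S p q) :
    ∃ b ∈ geodesicInterval (mulCayley (S : Set G)) y z, wordDist S p b ≤ 2 * N + 1 := by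
  have hne : {b ∈ geodesicInterval (mulCayley (S : Set G)) y z |
      ∃ a ∈ A, wordDist S b a ≤ N}.Nonempty := by
    by_contra! h
    refine hpq.not_gt (hA.wordDist_lt_of_forall_lt hS hDN hp hq fun b hb a ha => ?_)
    rw [wordDist_comm]
    exact not_le.1 fun hba => Set.eq_empty_iff_forall_notMem.1 h b ⟨hb, a, ha, hba⟩
  -- The first point of `[y, z]`, as seen from `y`, that is `N`-close to `A`.
  obtain ⟨b, ⟨hb, a, ha, hba⟩, hmin⟩ := exists_mem_nearestProj (S := S) hne y
  cases hyb : wordDist S y b with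
  | zero =>
    obtain rfl : y = b := hS.connected.dist_eq_zero_iff.1 hyb
    have hpy := hp.2 a ha
    exact ⟨y, hb, by rw [wordDist_comm]; omega⟩
  | succ t =>
    obtain ⟨b', hb', hyb'⟩ := exists_mem_geodesicInterval_dist_eq hS.connected
      (x := y) (y := b) (t := t) (by rw [← wordDist]; omega)
    have hsub := geodesicInterval_subset_left hS.connected hb
    obtain ⟨r, hr⟩ := exists_mem_nearestProj (S := S) ⟨a, ha⟩ b'
    have hpr : wordDist S p r < N := by
      refine hA.wordDist_lt_of_forall_lt hS hDN hp hr fun c hc a' ha' => ?_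
      by_contra! hle
      rw [wordDist_comm] at hle
      have hbc := hmin c
        ⟨hsub (geodesicInterval_subset_left hS.connected hb' hc), a', ha', hle⟩
      simp only [wordDist, mem_geodesicInterval] at *
      omega
    have hbr := hr.2 a ha
    have h₁ : wordDist S b' a ≤ wordDist S b' b + wordDist S b a := hS.connected.dist_triangle
    have h₂ : wordDist S p b' ≤ wordDist S p r + wordDist S r b' := hS.connected.dist_triangle
    have h₃ : wordDist S r b' = wordDist S b' r := wordDist_comm _ _
    exact ⟨b', hsub hb', by simp only [wordDist, mem_geodesicInterval] at *; omega⟩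

theorem isSlim_of_forall_isContracting {D : ℝ} {N : ℕ} (hS : Generates S) (hDN : D ≤ N)
    (h : ∀ A, IsGeodesicSegment S A → IsContracting S D A) :
    IsSlim (mulCayley (S : Set G)) (3 * N + 1) := by
  intro x y z m hm
  obtain ⟨A, hA, hxA, hmA, hAsub⟩ := hS.exists_isGeodesicSegment x m
  have hcontr := h A hA
  have hx : x ∈ nearestProj S A x := ⟨hxA, fun b _ => by simp [wordDist]⟩
  have hz : m ∈ nearestProj S A z := ⟨hmA, fun b hb => by
    have hbx := hAsub hb
    have h₁ : wordDist S x z ≤ wordDist S x b + wordDist S b z := hS.connected.dist_triangle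
    rw [wordDist_comm z, wordDist_comm z]
    simp only [wordDist, mem_geodesicInterval] at *
    omega⟩
  obtain ⟨r, hr⟩ := exists_mem_nearestProj (S := S) ⟨x, hxA⟩ y
  have htri (c : G) : wordDist S m c ≤ wordDist S m r + wordDist S r c :=
    hS.connected.dist_triangle
  rcases le_or_gt N (wordDist S m r) with hmr | hmr
  · obtain ⟨b, hb, hmb⟩ := hcontr.exists_wordDist_le hS hDN hz hr hmr
    rw [geodesicInterval_comm] at hb
    exact ⟨b, Or.inr hb, hmb.trans (by omega)⟩
  rcases le_or_gt N (wordDist S r x) with hrx | hrx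
  · obtain ⟨b, hb, hrb⟩ := hcontr.exists_wordDist_le hS hDN hr hx hrx
    rw [geodesicInterval_comm] at hb
    exact ⟨b, Or.inl hb, (htri b).trans (by omega)⟩
  · exact ⟨x, Or.inl left_mem_geodesicInterval, (htri x).trans (by omega)⟩

theorem IsSlim.isContracting {η : ℕ} (h : IsSlim (mulCayley (S : Set G)) η) (hS : Generates S)
    (hA : IsGeodesic S A) : IsContracting S (8 * η + 2 : ℕ) A := by
  intro B hB hfar p hp q hq
  obtain ⟨y, hy, hpA, hyp⟩ := Set.mem_iUnion₂.1 hp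
  obtain ⟨z, hz, hqA, hzq⟩ := Set.mem_iUnion₂.1 hq
  by_contra! hpq
  replace hpq : 8 * η + 2 ≤ wordDist S p q := by exact_mod_cast hpq
  obtain ⟨m, hmA, hm, hpm⟩ := hA.exists_mem_geodesicInterval_wordDist_eq hpA hqA
    (t := 4 * η + 1) (by omega)
  simp only [wordDist] at hpm hpq hyp hzq hfar
  rcases h.exists_dist_le_of_quadrilateral hS.connected hm (hyp m hmA) (hzq m hmA) with
    ⟨b, hb, hmb⟩ | hle | hle
  · obtain ⟨b', hb'B, hb', hyb'⟩ := hB.exists_mem_geodesicInterval_wordDist_eq hy hz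
      (t := wordDist S y b) (Nat.le_of_add_right_le hb.le)
    have hbb' := h.dist_le_two_mul hS.connected hb hb' hyb'.symm
    have hmb' : wordDist S m b' ≤ wordDist S m b + wordDist S b b' :=
      hS.connected.dist_triangle
    have hlt := Nat.cast_lt.1 (hfar m hmA b' hb'B)
    simp only [wordDist] at hmb'
    omega
  · omega
  · rw [mem_geodesicInterval] at hm
    omega

end Contracting

theorem IsHyperbolicGroup.exists_forall_isContracting {G : Type*} [Group G] {S : Finset G}
    (hG : IsHyperbolicGroup G) (hS : Generates S) :
    ∃ D : ℝ, 0 < D ∧ ∀ A : Set G, IsGeodesic S A → IsContracting S D A := by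
  obtain ⟨T, hT, hyp⟩ := hG
  obtain ⟨δ, hδ⟩ := isGromovHyperbolic_iff_exists_isFourPoint.1 hyp
  obtain ⟨M, Λ, hφ⟩ := exists_isBiLipschitz_id hS hT
  obtain ⟨η, hη⟩ := hδ.exists_isSlim_of_isBiLipschitz hS.connected hT.connected hφ
  exact ⟨(8 * η + 2 : ℕ), by positivity, fun A hA => hη.isContracting hS hA⟩

theorem isHyperbolicGroup_of_forall_isContracting {G : Type*} [Group G] {S : Finset G} {D : ℝ}
    (hS : Generates S) (h : ∀ A, IsGeodesicSegment S A → IsContracting S D A) :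
    IsHyperbolicGroup G :=
  ⟨S, hS, isGromovHyperbolic_iff_exists_isFourPoint.2
    ⟨_, (isSlim_of_forall_isContracting hS (Nat.le_ceil D) h).isFourPoint hS.connected⟩⟩

theorem proposition3p3 {G : Type*} [Group G] (S : Finset G) (hS : Generates S) :
    -- the trichotomy, with what holds in each case
    ((IsHyperbolicGroup G ∧
        ∃ D : ℝ, 0 < D ∧ ∀ A : Set G, IsGeodesic S A → IsContracting S D A) ∨
      (¬ ∃ g : G, IsContractingElement S g) ∨
      (¬ IsHyperbolicGroup G ∧ (∃ g : G, IsContractingElement S g) ∧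
        ∀ D : ℝ, 0 < D → ∃ A : Set G, IsGeodesicSegment S A ∧ ¬ IsContracting S D A)) ∧
    -- the first case, also when there is no contracting element
    (IsHyperbolicGroup G →
      ∃ D : ℝ, 0 < D ∧ ∀ A : Set G, IsGeodesic S A → IsContracting S D A) ∧
    -- uniformly contracting segments force hyperbolicity
    ((∃ D : ℝ, 0 < D ∧ ∀ A : Set G, IsGeodesicSegment S A → IsContracting S D A) →
      IsHyperbolicGroup G) := by
  have contracting (hG : IsHyperbolicGroup G) := hG.exists_forall_isContracting hS
  refine ⟨?_, contracting, fun ⟨D, _, hD⟩ => isHyperbolicGroup_of_forall_isContracting hS hD⟩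
  by_cases hG : IsHyperbolicGroup G
  · exact Or.inl ⟨hG, contracting hG⟩
  by_cases hg : ∃ g : G, IsContractingElement S g
  · refine Or.inr (Or.inr ⟨hG, hg, fun D _ => ?_⟩)
    by_contra! hD
    exact hG (isHyperbolicGroup_of_forall_isContracting hS hD)
  · exact Or.inr (Or.inl hg)
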